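/- Let $G=\langle S,A,\Gamma_1,\Gamma_2,\delta\rangle$ be a finite two-player concurrent game structure: $S$ is a finite set of states, $A$ a finite set of moves, $\Gamma_i(s)\subseteq A$ the nonempty set of moves available to player $i$ at $s$, and $\delta(s,a_1,a_2)$ a probability distribution on $S$ for all $s\in S$, $a_1,a_2\in A$. Let $T\subseteq S$ be a set of target states, and let $\mathrm{Reach}(T)$ be the set of plays $s_0s_1s_2\dots$ with $s_k\in T$ for some $k\ge 0$. A strategy of player $i$ maps each finite nonempty history $w\cdot s$ to a probability distribution on $\Gamma_i(s)$; a selector $\xi$ of player $i$ assigns to each state $s$ a probability distribution $\xi(s)$ on $\Gamma_i(s)$, and $\overline{\xi}$ is the memoryless strategy that plays $\xi$ forever. For strategies $\sigma_1,\sigma_2$ of the two players let $\Pr_s^{\sigma_1,\sigma_2}$ be the law of the play started at $s$. Put $$\langle 1\rangle^{\sigma_1}(s)=\inf_{\sigma_2}\Pr_s^{\sigma_1,\sigma_2}(\mathrm{Reach}(T)),\qquad \mathrm{Val}(s)=\sup_{\sigma_1}\langle 1\rangle^{\sigma_1}(s),\qquad W_2=\{s\in S:\mathrm{Val}(s)=0\}.$$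 A player-1 strategy $\sigma_1$ is optimal if $\langle 1\rangle^{\sigma_1}=\mathrm{Val}$, and proper if $\Pr_s^{\sigma_1,\sigma_2}(\mathrm{Reach}(T\cup W_2))=1$ for every player-2 strategy $\sigma_2$ and every $s\in S\setminus(T\cup W_2)$. For player-1 strategies, $\sigma\prec\sigma'$ means that $\langle 1\rangle^{\sigma}\le\langle 1\rangle^{\sigma'}$ pointwise with strict inequality at some state, and $\sigma\preceq\sigma'$ means that $\sigma\prec\sigma'$ or $\sigma=\sigma'$. For $v:S\to[0,1]$ put $$\mathrm{Pre}_{1:\xi_1}(v)(s)=\inf_{\xi_2}\sum_{a,b\in A}\sum_{t\in S}v(t)\,\delta(s,a,b)(t)\,\xi_1(s)(a)\,\xi_2(s)(b),\qquad \mathrm{Pre}_1(v)(s)=\sup_{\xi_1}\mathrm{Pre}_{1:\xi_1}(v)(s),$$ where $\xi_1,\xi_2$ range over the selectors of players 1 and 2. The reachability strategy-improvement algorithm generates player-1 selectors $\gamma_0,\gamma_1,\gamma_2,\dots$ as follows. The selector $\gamma_0$ plays, at every state $s\in S\setminus(T\cup W_2)$, all moves in $\Gamma_1(s)$ uniformly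 at random (on $T\cup W_2$ it is arbitrary). Given $\gamma_i$, let $v_i=\langle 1\rangle^{\overline{\gamma}_i}$ and $I_i=\{s\in S\setminus(T\cup W_2):\mathrm{Pre}_1(v_i)(s)>v_i(s)\}$, choose any player-1 selector $\xi_1$ with $\mathrm{Pre}_{1:\xi_1}(v_i)(s)=\mathrm{Pre}_1(v_i)(s)$ for all $s\in I_i$, and let $\gamma_{i+1}(s)=\xi_1(s)$ for $s\in I_i$ and $\gamma_{i+1}(s)=\gamma_i(s)$ for $s\notin I_i$. (The algorithm stops when $I_i=\emptyset$; then $\gamma_{i+1}=\gamma_i$, and the sequence is continued by repeating $\gamma_i$.) **Theorem (Strategy improvement).** For every sequence $(\gamma_i)_{i\ge0}$ generated by the algorithm: 1. for all $i\ge 0$, $\overline{\gamma}_i\preceq\overline{\gamma}_{i+1}$; moreover, if $\overline{\gamma}_i=\overline{\gamma}_{i+1}$, then $\overline{\gamma}_i$ is an optimal strategy; 2. every $\overline{\gamma}_i$ is proper, and $\lim_{i\to\infty}v_i=\lim_{i\to\infty}\langle 1\rangle^{\overline{\gamma}_i}=\mathrm{Val}$ pointwise on $S$. -/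

import Mathlib

open MeasureTheory ProbabilityTheory Filter Topology

/-- A (two-player) concurrent game structure with finite state space `S` and finite set of
moves `A`. Probability distributions on a finite type are points of the standard simplex. -/
structure ConcurrentGame (S A : Type*) [Fintype S] [Fintype A] where
  /-- moves available to player 1 -/
  mov₁ : S → Finset A
  /-- moves available to player 2 -/
  mov₂ : S → Finset A
  mov₁_nonempty : ∀ s, (mov₁ s).Nonempty
  mov₂_nonempty : ∀ s, (mov₂ s).Nonempty
  /-- `trans s a b t` is the probability of moving from `s` to `t` under the moves `a`, `b` -/
  trans : S → A → A → S → ℝ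
  trans_mem : ∀ s a b, trans s a b ∈ stdSimplex ℝ S

/-- A selector for the player with move assignment `mov`: a distribution over the available
moves at every state. -/
@[ext]
structure Selector {S A : Type*} [Fintype A] (mov : S → Finset A) where
  /-- probability of a move at a state -/
  act : S → A → ℝ
  act_mem : ∀ s, act s ∈ stdSimplex ℝ A
  supp : ∀ s a, 0 < act s a → a ∈ mov s

/-- A strategy for the player with move assignment `mov`: it maps each finite nonempty sequence
of states `w · s` (past states `w` in chronological order, current state `s`) to a distribution
over the moves available at `s`. -/
@[ext]
structure Strategy {S A : Type*} [Fintype A] (mov : S → Finset A) where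
  /-- probability of a move after a history -/
  act : List S → S → A → ℝ
  act_mem : ∀ w s, act w s ∈ stdSimplex ℝ A
  supp : ∀ w s a, 0 < act w s a → a ∈ mov s

/-- The memoryless strategy that plays a selector forever. -/
def Selector.memoryless {S A : Type*} [Fintype A] {mov : S → Finset A} (ξ : Selector mov) :
    Strategy mov where
  act _ s := ξ.act s
  act_mem _ s := ξ.act_mem s
  supp _ s := ξ.supp s

namespace ConcurrentGame

variable {S A : Type*} [Fintype S] [Fintype A]

/-! ### The one-step operators -/

/-- `Pre_{ξ₁,ξ₂}(v)(s)` -/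
def preBoth (G : ConcurrentGame S A) (ξ₁ : Selector G.mov₁) (ξ₂ : Selector G.mov₂)
    (v : S → ℝ) (s : S) : ℝ :=
  ∑ a : A, ∑ b : A, ∑ t : S, v t * G.trans s a b t * ξ₁.act s a * ξ₂.act s b

/-- `Pre_{1:ξ₁}(v)(s)` -/
noncomputable def preSel (G : ConcurrentGame S A) (ξ₁ : Selector G.mov₁)
    (v : S → ℝ) (s : S) : ℝ :=
  ⨅ ξ₂ : Selector G.mov₂, G.preBoth ξ₁ ξ₂ v s

/-- `Pre_1(v)(s)` -/
noncomputable def pre (G : ConcurrentGame S A) (v : S → ℝ) (s : S) : ℝ :=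
  ⨆ ξ₁ : Selector G.mov₁, ⨅ ξ₂ : Selector G.mov₂, G.preBoth ξ₁ ξ₂ v s

/-! ### The probability measure on plays -/

/-- The probability that the next state is `t`, after the history `w · s`. -/
def stepProb (G : ConcurrentGame S A) (σ₁ : Strategy G.mov₁) (σ₂ : Strategy G.mov₂)
    (w : List S) (s t : S) : ℝ :=
  ∑ a : A, ∑ b : A, G.trans s a b t * σ₁.act w s a * σ₂.act w s b

theorem stepProb_nonneg (G : ConcurrentGame S A) (σ₁ : Strategy G.mov₁) (σ₂ : Strategy G.mov₂)
    (w : List S) (s t : S) : 0 ≤ G.stepProb σ₁ σ₂ w s t :=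
  Finset.sum_nonneg fun a _ => Finset.sum_nonneg fun b _ =>
    mul_nonneg (mul_nonneg ((G.trans_mem s a b).1 t) ((σ₁.act_mem w s).1 a))
      ((σ₂.act_mem w s).1 b)

theorem sum_stepProb (G : ConcurrentGame S A) (σ₁ : Strategy G.mov₁) (σ₂ : Strategy G.mov₂)
    (w : List S) (s : S) : ∑ t : S, G.stepProb σ₁ σ₂ w s t = 1 := by
  unfold stepProb
  rw [Finset.sum_comm]
  simp_rw [Finset.sum_comm (s := (Finset.univ : Finset S)), ← Finset.sum_mul,
    (G.trans_mem s _ _).2, one_mul, ← Finset.mul_sum, (σ₂.act_mem w s).2, mul_one]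
  exact (σ₁.act_mem w s).2

variable [MeasurableSpace S]

/-- The distribution of the next state after the history `w · s`, as a measure. -/
noncomputable def stepMeasure (G : ConcurrentGame S A) (σ₁ : Strategy G.mov₁)
    (σ₂ : Strategy G.mov₂) (w : List S) (s : S) : Measure S :=
  ∑ t : S, ENNReal.ofReal (G.stepProb σ₁ σ₂ w s t) • Measure.dirac t

theorem isProbabilityMeasure_stepMeasure (G : ConcurrentGame S A) (σ₁ : Strategy G.mov₁)
    (σ₂ : Strategy G.mov₂) (w : List S) (s : S) :
    IsProbabilityMeasure (G.stepMeasure σ₁ σ₂ w s) := by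
  constructor
  simp only [stepMeasure, Measure.finsetSum_apply, Measure.smul_apply, measure_univ,
    smul_eq_mul, mul_one]
  rw [← ENNReal.ofReal_sum_of_nonneg fun t _ => G.stepProb_nonneg σ₁ σ₂ w s t,
    G.sum_stepProb σ₁ σ₂ w s, ENNReal.ofReal_one]

variable [DiscreteMeasurableSpace S]

/-- The transition kernel from the first `n + 1` states of a play to the next state. -/
noncomputable def stepKernel (G : ConcurrentGame S A) (σ₁ : Strategy G.mov₁)
    (σ₂ : Strategy G.mov₂) (n : ℕ) : Kernel (Finset.Iic n → S) S where
  toFun h := G.stepMeasure σ₁ σ₂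
    (List.ofFn fun i : Fin n => h ⟨i, Finset.mem_Iic.2 i.isLt.le⟩)
    (h ⟨n, Finset.mem_Iic.2 le_rfl⟩)
  measurable' := measurable_of_countable _

instance (G : ConcurrentGame S A) (σ₁ : Strategy G.mov₁) (σ₂ : Strategy G.mov₂) (n : ℕ) :
    IsMarkovKernel (G.stepKernel σ₁ σ₂ n) :=
  ⟨fun _ => G.isProbabilityMeasure_stepMeasure σ₁ σ₂ _ _⟩

/-- The law of the play `s₀ s₁ s₂ …` when the game starts at `s` and the players follow
`σ₁` and `σ₂` (Ionescu-Tulcea). -/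
noncomputable def playMeasure (G : ConcurrentGame S A) (σ₁ : Strategy G.mov₁)
    (σ₂ : Strategy G.mov₂) (s : S) : Measure (ℕ → S) :=
  Kernel.traj (X := fun _ => S) (G.stepKernel σ₁ σ₂) 0 (fun _ => s)

/-- The event that the play visits `T`. -/
def reach (T : Set S) : Set (ℕ → S) := {ω | ∃ k, ω k ∈ T}

/-! ### Values, optimal and proper strategies -/

/-- The probability that player 1 guarantees for the objective `Φ` by playing `σ₁`. -/
noncomputable def stratValue (G : ConcurrentGame S A) (σ₁ : Strategy G.mov₁)
    (Φ : Set (ℕ → S)) (s : S) : ℝ :=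
  ⨅ σ₂ : Strategy G.mov₂, (G.playMeasure σ₁ σ₂ s).real Φ

/-- The value of the game for player 1 with objective `Φ`. -/
noncomputable def val (G : ConcurrentGame S A) (Φ : Set (ℕ → S)) (s : S) : ℝ :=
  ⨆ σ₁ : Strategy G.mov₁, ⨅ σ₂ : Strategy G.mov₂, (G.playMeasure σ₁ σ₂ s).real Φ

/-- `σ₁` is an optimal strategy of player 1 for the objective `Φ`. -/
def IsOptimal (G : ConcurrentGame S A) (σ₁ : Strategy G.mov₁) (Φ : Set (ℕ → S)) : Prop :=
  ∀ s, G.stratValue σ₁ Φ s = G.val Φ s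

/-- The set `W₂` of states where the value of `Reach(T)` is zero. -/
def W₂ (G : ConcurrentGame S A) (T : Set S) : Set S := {s | G.val (reach T) s = 0}

/-- Proper strategies of player 1. -/
def IsProper (G : ConcurrentGame S A) (T : Set S) (σ₁ : Strategy G.mov₁) : Prop :=
  ∀ σ₂ : Strategy G.mov₂, ∀ s, s ∉ T ∪ G.W₂ T →
    (G.playMeasure σ₁ σ₂ s).real (reach (T ∪ G.W₂ T)) = 1

/-- The strict order `σ ≺ σ'` on strategies of player 1. -/
def Prec (G : ConcurrentGame S A) (T : Set S) (σ σ' : Strategy G.mov₁) : Prop :=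
  (∀ s, G.stratValue σ (reach T) s ≤ G.stratValue σ' (reach T) s) ∧
    ∃ s, G.stratValue σ (reach T) s < G.stratValue σ' (reach T) s

/-- The order `σ ⪯ σ'` on strategies of player 1. -/
def PrecEq (G : ConcurrentGame S A) (T : Set S) (σ σ' : Strategy G.mov₁) : Prop :=
  G.Prec T σ σ' ∨ σ = σ'

/-! ### The strategy-improvement algorithm -/

/-- The selector `ξ` plays all available moves uniformly at random at all states outside
`T ∪ W₂` (what it does on `T ∪ W₂` is not prescribed). -/
def IsUniform (G : ConcurrentGame S A) (T : Set S) (ξ : Selector G.mov₁) : Prop :=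
  ∀ s, s ∉ T ∪ G.W₂ T → ∀ a ∈ G.mov₁ s, ξ.act s a = 1 / ((G.mov₁ s).card : ℝ)

/-- The set `I` of states outside `T ∪ W₂` where the valuation `v` can be improved. -/
def improvable (G : ConcurrentGame S A) (T : Set S) (v : S → ℝ) : Set S :=
  {s | s ∉ T ∪ G.W₂ T ∧ v s < G.pre v s}

/-- One iteration of the loop, from the selector `γ` to the selector `γ'`: on `I`, replace `γ`
by some selector that is value-optimal there for the valuation of `γ`. -/
def ImprovementStep (G : ConcurrentGame S A) (T : Set S) (γ γ' : Selector G.mov₁) : Prop :=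
  ∃ ξ₁ : Selector G.mov₁,
    (∀ s ∈ G.improvable T (G.stratValue γ.memoryless (reach T)),
      G.preSel ξ₁ (G.stratValue γ.memoryless (reach T)) s =
        G.pre (G.stratValue γ.memoryless (reach T)) s) ∧
    ∀ s, (s ∉ G.improvable T (G.stratValue γ.memoryless (reach T)) → γ'.act s = γ.act s) ∧
      (s ∈ G.improvable T (G.stratValue γ.memoryless (reach T)) → γ'.act s = ξ₁.act s)

/-- `γ 0, γ 1, …` is a sequence of selectors generated by the reachability strategy-improvement
algorithm. The algorithm stops when `I` is empty; an iteration with empty `I` does not change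
the selector, so a terminated execution appears here with its final selector repeated. -/
def IsRun (G : ConcurrentGame S A) (T : Set S) (γ : ℕ → Selector G.mov₁) : Prop :=
  G.IsUniform T (γ 0) ∧ ∀ i, G.ImprovementStep T (γ i) (γ (i + 1))

end ConcurrentGame

/-! Against a fixed selector player 2 faces a Markov decision process, and properness is controlled
by traps: sets disjoint from `T ∪ W₂` to which player 2 can confine the play. If a selector has no
nonempty trap, a maximum principle holds (`IsTrapFree.le_of_le_moveVal`): where a function is at
most its mean under some reply of player 2, its maximum propagates to all successors, so a maximum
above the boundary bound would be attained on a trap. Hence a subharmonic valuation with the right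
boundary bounds lies below the value of the selector (`IsTrapFree.le_stratValue`), and the selector
is proper.

The uniform selector is trap-free, because its traps are traps against every selector and so lie in
`W₂`. An improvement step preserves trap-freeness (`ImprovementStep.isTrapFree`). The old valuation
`v` is subharmonic for the new selector, so values increase, and the new value even dominates
`Pre₁(v)` outside `T ∪ W₂`, which makes the increase strict on the improvable set.

From above, the value of the game is bounded by every nonnegative `u` that is at least `1` on `T`
and satisfies `Pre₁(u) ≤ u` off `T` (`val_reach_le_of_pre_le`). This applies to the valuation at
termination and to the limit of the valuations, so no optimal strategy is needed for convergence.
The law of the play enters only through the recursion for reaching `T` within `n` rounds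
(`traj_reachWithin`). -/

/-! ### Operations on strategies -/

namespace Strategy

variable {S A : Type*} [Fintype A] {mov : S → Finset A}

/-- The continuation of a strategy after the first state of the play was `x`. -/
def shift (σ : Strategy mov) (x : S) : Strategy mov where
  act w s := σ.act (x :: w) s
  act_mem w s := σ.act_mem (x :: w) s
  supp w s := σ.supp (x :: w) s

/-- Play `ξ` in the first round and then follow `σ`, disregarding the first state. -/
def cons (ξ : Selector mov) (σ : Strategy mov) : Strategy mov where
  act
    | [], s => ξ.act s
    | _ :: w, s => σ.act w s
  act_mem
    | [], s => ξ.act_mem s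
    | _ :: w, s => σ.act_mem w s
  supp
    | [], s => ξ.supp s
    | _ :: w, s => σ.supp w s

/-- Follow `τ t`, where `t` is the first state of the play. -/
def select (τ : S → Strategy mov) : Strategy mov where
  act w s := (τ (w.headD s)).act w s
  act_mem w s := (τ (w.headD s)).act_mem w s
  supp w s := (τ (w.headD s)).supp w s

/-- The selector used by a strategy when the past states are `w`. -/
def selectorAt (σ : Strategy mov) (w : List S) : Selector mov where
  act s := σ.act w s
  act_mem s := σ.act_mem w s
  supp s := σ.supp w s

open Classical in
/-- The deterministic strategy given by a choice of available moves. -/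
noncomputable def ofMoves (f : List S → S → A) (hf : ∀ w s, f w s ∈ mov s) : Strategy mov where
  act w s := Pi.single (f w s) 1
  act_mem w s := single_mem_stdSimplex ℝ (f w s)
  supp w s a h := by
    by_cases ha : a = f w s
    · exact ha ▸ hf w s
    · rw [Pi.single_eq_of_ne ha] at h
      exact absurd h (lt_irrefl 0)

theorem shift_cons (ξ : Selector mov) (σ : Strategy mov) (x : S) : (cons ξ σ).shift x = σ := rfl

end Strategy

theorem Selector.shift_memoryless {S A : Type*} [Fintype A] {mov : S → Finset A}
    (ξ : Selector mov) (x : S) : ξ.memoryless.shift x = ξ.memoryless := rfl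

namespace ConcurrentGame

variable {S A : Type*} [Fintype S] [Fintype A]

/-! ### Reachability within finitely many rounds -/

open Classical in
/-- The probability that `T` is visited within the next `n` rounds after the history `w · s`, the
current state `s` included. -/
noncomputable def reachWithin (G : ConcurrentGame S A) (σ₁ : Strategy G.mov₁)
    (σ₂ : Strategy G.mov₂) (T : Set S) : ℕ → List S → S → ℝ
  | 0, _, s => if s ∈ T then 1 else 0
  | n + 1, w, s => if s ∈ T then 1 else
      ∑ t, G.stepProb σ₁ σ₂ w s t * G.reachWithin σ₁ σ₂ T n (w ++ [s]) t

variable {G : ConcurrentGame S A} {T : Set S} {σ₁ τ₁ : Strategy G.mov₁} {σ₂ τ₂ : Strategy G.mov₂}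

theorem reachWithin_of_mem {s : S} (hs : s ∈ T) (n : ℕ) (w : List S) :
    G.reachWithin σ₁ σ₂ T n w s = 1 := by
  cases n <;> simp [reachWithin, hs]

theorem reachWithin_zero_of_notMem {s : S} (hs : s ∉ T) (w : List S) :
    G.reachWithin σ₁ σ₂ T 0 w s = 0 := by
  simp [reachWithin, hs]

theorem reachWithin_succ_of_notMem {s : S} (hs : s ∉ T) (n : ℕ) (w : List S) :
    G.reachWithin σ₁ σ₂ T (n + 1) w s =
      ∑ t, G.stepProb σ₁ σ₂ w s t * G.reachWithin σ₁ σ₂ T n (w ++ [s]) t := by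
  simp [reachWithin, hs]

theorem reachWithin_nonneg (n : ℕ) (w : List S) (s : S) : 0 ≤ G.reachWithin σ₁ σ₂ T n w s := by
  induction n generalizing w s with
  | zero => rw [reachWithin]; positivity
  | succ n ih =>
    by_cases hs : s ∈ T
    · rw [reachWithin_of_mem hs]; exact zero_le_one
    · rw [reachWithin_succ_of_notMem hs]
      exact Finset.sum_nonneg fun t _ => mul_nonneg (G.stepProb_nonneg _ _ _ _ _) (ih _ _)

theorem reachWithin_cons (x : S) (n : ℕ) (w : List S) (s : S) :
    G.reachWithin σ₁ σ₂ T n (x :: w) s =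
      G.reachWithin (σ₁.shift x) (σ₂.shift x) T n w s := by
  induction n generalizing w s with
  | zero => rfl
  | succ n ih =>
    by_cases hs : s ∈ T
    · rw [reachWithin_of_mem hs, reachWithin_of_mem hs]
    · rw [reachWithin_succ_of_notMem hs, reachWithin_succ_of_notMem hs]
      refine Finset.sum_congr rfl fun t _ => ?_
      rw [List.cons_append, ih]
      rfl

/-- `Q` is an invariant of histories, stable under every one-state extension; only the histories
satisfying it can follow the initial one. -/
theorem reachWithin_congr (Q : List S → S → Prop) (hQ : ∀ w s t, Q w s → Q (w ++ [s]) t)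
    (h : ∀ w s, Q w s → ∀ t, G.stepProb σ₁ σ₂ w s t = G.stepProb τ₁ τ₂ w s t)
    (n : ℕ) {w : List S} {s : S} (hws : Q w s) :
    G.reachWithin σ₁ σ₂ T n w s = G.reachWithin τ₁ τ₂ T n w s := by
  induction n generalizing w s with
  | zero => rfl
  | succ n ih =>
    by_cases hs : s ∈ T
    · rw [reachWithin_of_mem hs, reachWithin_of_mem hs]
    · rw [reachWithin_succ_of_notMem hs, reachWithin_succ_of_notMem hs]
      refine Finset.sum_congr rfl fun t _ => ?_
      rw [ih (hQ w s t hws), h w s hws]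

theorem reachWithin_select (τ : S → Strategy G.mov₂) (n : ℕ) (s : S) :
    G.reachWithin σ₁ (Strategy.select τ) T n [] s = G.reachWithin σ₁ (τ s) T n [] s := by
  -- The invariant says that the play began at `s`; with empty past the first state is the current
  -- one.
  refine reachWithin_congr (fun w t => w.headD t = s) ?_ ?_ n rfl
  · rintro (_ | _) t u h <;> exact h
  · rintro w t rfl u
    rfl

/-! ### The law of the play -/

variable [MeasurableSpace S] [DiscreteMeasurableSpace S]

instance (σ₁ : Strategy G.mov₁) (σ₂ : Strategy G.mov₂) (s : S) :
    IsProbabilityMeasure (G.playMeasure σ₁ σ₂ s) := by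
  unfold playMeasure; infer_instance

theorem lintegral_stepKernel (n : ℕ) (h : Finset.Iic n → S) (f : S → ENNReal) :
    ∫⁻ t, f t ∂(G.stepKernel σ₁ σ₂ n h) = ∑ t, ENNReal.ofReal (G.stepProb σ₁ σ₂
      (List.ofFn fun i : Fin n => h ⟨i, Finset.mem_Iic.2 i.isLt.le⟩)
      (h ⟨n, Finset.mem_Iic.2 le_rfl⟩) t) * f t := by
  change ∫⁻ t, f t ∂(G.stepMeasure σ₁ σ₂ _ _) = _
  simp [stepMeasure, lintegral_smul_measure, lintegral_dirac]

/-- The marginal on the states already given is a Dirac mass, since no round is played between `n`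
and `n`. -/
theorem ae_traj_apply_self (n : ℕ) (h : Finset.Iic n → S) :
    ∀ᵐ ω ∂(Kernel.traj (X := fun _ => S) (G.stepKernel σ₁ σ₂) n h),
      Preorder.frestrictLe n ω = h := by
  have key := Kernel.traj_map_frestrictLe_apply (X := fun _ => S) (κ := G.stepKernel σ₁ σ₂) n n h
  rw [Kernel.partialTraj_self, Kernel.id_apply] at key
  have h1 : ∀ᵐ g ∂((Kernel.traj (X := fun _ => S) (G.stepKernel σ₁ σ₂) n h).map
      (Preorder.frestrictLe n)), g = h := by
    rw [key, ae_dirac_eq]; rfl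
  exact ae_of_ae_map (by fun_prop) h1

theorem lintegral_partialTraj_succ (n : ℕ) (h : Finset.Iic n → S)
    (f : (Finset.Iic (n + 1) → S) → ENNReal) :
    ∫⁻ h', f h' ∂(Kernel.partialTraj (X := fun _ => S) (G.stepKernel σ₁ σ₂) n (n + 1) h) =
      ∑ t, ENNReal.ofReal (G.stepProb σ₁ σ₂
        (List.ofFn fun i : Fin n => h ⟨i, Finset.mem_Iic.2 i.isLt.le⟩)
        (h ⟨n, Finset.mem_Iic.2 le_rfl⟩) t) *
        f (fun i => if hi : i.1 ≤ n then h ⟨i, Finset.mem_Iic.2 hi⟩ else t) := by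
  have hf : Measurable f := measurable_of_countable _
  rw [Kernel.partialTraj_succ_self, Kernel.lintegral_map _ (by fun_prop) _ hf,
    Kernel.lintegral_id_prod (by fun_prop), Kernel.lintegral_map _ (by fun_prop) _ (by fun_prop),
    lintegral_stepKernel]
  refine Finset.sum_congr rfl fun t _ => ?_
  congr 2
  ext i
  simp only [IicProdIoc]
  split_ifs with hi
  · rfl
  · obtain rfl : i = ⟨n + 1, Finset.mem_Iic.2 le_rfl⟩ := by
      apply Subtype.ext
      have := Finset.mem_Iic.1 i.2
      change i.1 = n + 1
      omega
    rfl

/-- Bridge between the Ionescu-Tulcea measure and the recursion: disintegrate over the next state,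
extend the history by it, and induct on the number of rounds. -/
theorem traj_reachWithin (n m : ℕ) (h : Finset.Iic m → S) :
    Kernel.traj (X := fun _ => S) (G.stepKernel σ₁ σ₂) m h {ω | ∃ k ≤ n, ω (m + k) ∈ T} =
      ENNReal.ofReal (G.reachWithin σ₁ σ₂ T n
        (List.ofFn fun i : Fin m => h ⟨i, Finset.mem_Iic.2 i.isLt.le⟩)
        (h ⟨m, Finset.mem_Iic.2 le_rfl⟩)) := by
  classical
  have hmeas : ∀ n m : ℕ, MeasurableSet {ω : ℕ → S | ∃ k ≤ n, ω (m + k) ∈ T} := fun n m => by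
    have : {ω : ℕ → S | ∃ k ≤ n, ω (m + k) ∈ T} =
        ⋃ k, ⋃ (_ : k ≤ n), (fun ω : ℕ → S => ω (m + k)) ⁻¹' T := by
      ext; simp
    rw [this]
    exact MeasurableSet.iUnion fun k => MeasurableSet.iUnion fun _ =>
      measurable_pi_apply _ (MeasurableSet.of_discrete)
  have hself : ∀ (m : ℕ) (h : Finset.Iic m → S),
      ∀ᵐ ω ∂(Kernel.traj (X := fun _ => S) (G.stepKernel σ₁ σ₂) m h),
        ω m = h ⟨m, Finset.mem_Iic.2 le_rfl⟩ := fun m h => by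
    filter_upwards [ae_traj_apply_self m h] with ω hω
    rw [← hω]; rfl
  by_cases hs : h ⟨m, Finset.mem_Iic.2 le_rfl⟩ ∈ T
  · rw [reachWithin_of_mem hs, ENNReal.ofReal_one, ← mem_ae_iff_prob_eq_one (hmeas n m)]
    filter_upwards [hself m h] with ω hω
    exact ⟨0, Nat.zero_le _, by rw [add_zero, hω]; exact hs⟩
  induction n generalizing m with
  | zero =>
    rw [reachWithin_zero_of_notMem hs, ENNReal.ofReal_zero, measure_eq_zero_iff_ae_notMem]
    filter_upwards [hself m h] with ω hω
    rintro ⟨k, hk, hkT⟩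
    obtain rfl := Nat.le_zero.1 hk
    rw [add_zero, hω] at hkT
    exact hs hkT
  | succ n ih =>
    have hE : Kernel.traj (X := fun _ => S) (G.stepKernel σ₁ σ₂) m h
          {ω | ∃ k ≤ n + 1, ω (m + k) ∈ T} =
        Kernel.traj (X := fun _ => S) (G.stepKernel σ₁ σ₂) m h
          {ω | ∃ k ≤ n, ω (m + 1 + k) ∈ T} := by
      refine measure_congr ?_
      filter_upwards [hself m h] with ω hω
      refine propext ⟨?_, ?_⟩
      · rintro ⟨_ | k, hk, hkT⟩
        · rw [add_zero, hω] at hkT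
          exact absurd hkT hs
        · exact ⟨k, by omega, by rwa [add_assoc, add_comm 1 k]⟩
      · rintro ⟨k, hk, hkT⟩
        exact ⟨k + 1, by omega, by rwa [add_comm k 1, ← add_assoc]⟩
    rw [reachWithin_succ_of_notMem hs, hE, ← Kernel.traj_comp_partialTraj (Nat.le_succ m),
      Kernel.comp_apply' _ _ _ (hmeas n (m + 1)), lintegral_partialTraj_succ,
      ENNReal.ofReal_sum_of_nonneg fun t _ =>
        mul_nonneg (G.stepProb_nonneg _ _ _ _ _) (reachWithin_nonneg _ _ _)]
    refine Finset.sum_congr rfl fun t _ => ?_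
    rw [ENNReal.ofReal_mul (G.stepProb_nonneg _ _ _ _ _)]
    congr 1
    set h' : Finset.Iic (m + 1) → S :=
      fun i => if hi : i.1 ≤ m then h ⟨i, Finset.mem_Iic.2 hi⟩ else t with hh'
    have hlast : h' ⟨m + 1, Finset.mem_Iic.2 le_rfl⟩ = t := by simp [hh']
    have hlist : (List.ofFn fun i : Fin (m + 1) => h' ⟨i, Finset.mem_Iic.2 i.isLt.le⟩) =
        (List.ofFn fun i : Fin m => h ⟨i, Finset.mem_Iic.2 i.isLt.le⟩) ++
          [h ⟨m, Finset.mem_Iic.2 le_rfl⟩] := by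
      rw [List.ofFn_succ', List.concat_eq_append]
      congr 2
      · ext i
        simp [hh', i.isLt.le]
      · simp [hh']
    -- The case of a current state in `T` was split off before the induction, so `ih` covers only `t
    -- ∉ T`.
    by_cases ht : t ∈ T
    · rw [reachWithin_of_mem ht, ENNReal.ofReal_one, ← mem_ae_iff_prob_eq_one (hmeas n _)]
      filter_upwards [hself (m + 1) h'] with ω hω
      exact ⟨0, Nat.zero_le _, by rw [add_zero, hω, hlast]; exact ht⟩
    · rw [← hlist]
      have := ih (m + 1) h' (by rwa [hlast])
      rwa [hlast] at this

theorem tendsto_reachWithin (σ₁ : Strategy G.mov₁) (σ₂ : Strategy G.mov₂) (T : Set S) (s : S) :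
    Tendsto (fun n => G.reachWithin σ₁ σ₂ T n [] s) atTop
      (𝓝 ((G.playMeasure σ₁ σ₂ s).real (reach T))) := by
  have hU : (reach T : Set (ℕ → S)) = ⋃ n : ℕ, {ω | ∃ k ≤ n, ω (0 + k) ∈ T} := by
    ext ω
    simp only [reach, Set.mem_ofPred_eq, Set.mem_iUnion, zero_add]
    exact ⟨fun ⟨k, hk⟩ => ⟨k, k, le_rfl, hk⟩, fun ⟨_, k, _, hk⟩ => ⟨k, hk⟩⟩
  have hmono : Monotone fun n : ℕ => {ω : ℕ → S | ∃ k ≤ n, ω (0 + k) ∈ T} :=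
    fun n n' hn ω ⟨k, hk, hT⟩ => ⟨k, hk.trans hn, hT⟩
  have h := (ENNReal.tendsto_toReal (measure_ne_top (G.playMeasure σ₁ σ₂ s) _)).comp
    (tendsto_measure_iUnion_atTop (μ := G.playMeasure σ₁ σ₂ s) hmono)
  rw [← hU] at h
  refine h.congr fun n => ?_
  have := traj_reachWithin (G := G) (T := T) (σ₁ := σ₁) (σ₂ := σ₂) n 0 (fun _ => s)
  simp only [Function.comp_apply, playMeasure, this]
  exact ENNReal.toReal_ofReal (reachWithin_nonneg _ _ _)

theorem playMeasure_reach_of_mem {s : S} (hs : s ∈ T) :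
    (G.playMeasure σ₁ σ₂ s).real (reach T) = 1 :=
  tendsto_nhds_unique (tendsto_reachWithin σ₁ σ₂ T s)
    (tendsto_const_nhds.congr fun n => (reachWithin_of_mem hs n []).symm)

/-- Pass to the limit in the finite-horizon recursion; the shifts absorb the first state into the
strategies. -/
theorem playMeasure_reach_of_notMem {s : S} (hs : s ∉ T) :
    (G.playMeasure σ₁ σ₂ s).real (reach T) = ∑ t, G.stepProb σ₁ σ₂ [] s t *
      (G.playMeasure (σ₁.shift s) (σ₂.shift s) t).real (reach T) := by
  refine tendsto_nhds_unique ((tendsto_reachWithin σ₁ σ₂ T s).comp (tendsto_add_atTop_nat 1)) ?_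
  refine Tendsto.congr (f₁ := fun n => ∑ t, G.stepProb σ₁ σ₂ [] s t *
    G.reachWithin (σ₁.shift s) (σ₂.shift s) T n [] t) (fun n => ?_)
    (tendsto_finsetSum _ fun t _ => (tendsto_reachWithin _ _ T t).const_mul _)
  rw [Function.comp_apply, reachWithin_succ_of_notMem hs]
  refine Finset.sum_congr rfl fun t _ => ?_
  rw [List.nil_append, reachWithin_cons]

theorem playMeasure_reach_select (τ : S → Strategy G.mov₂) (s : S) :
    (G.playMeasure σ₁ (Strategy.select τ) s).real (reach T) =
      (G.playMeasure σ₁ (τ s) s).real (reach T) :=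
  tendsto_nhds_unique (tendsto_reachWithin _ _ T s)
    ((tendsto_reachWithin _ _ T s).congr fun n => (reachWithin_select τ n s).symm)

end ConcurrentGame

namespace ConcurrentGame

variable {S A : Type*} [Fintype S] [Fintype A]

/-! ### One-step operators and deterministic replies -/

/-- The probability of moving from `s` to `t` when player 1 plays `ξ` and player 2 the move `b`. -/
def nextProb (G : ConcurrentGame S A) (ξ : Selector G.mov₁) (s : S) (b : A) (t : S) : ℝ :=
  ∑ a, G.trans s a b t * ξ.act s a

/-- The expectation of `v` after one round from `s` when player 1 plays `ξ` and player 2 the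
move `b`. -/
def moveVal (G : ConcurrentGame S A) (ξ : Selector G.mov₁) (v : S → ℝ) (s : S) (b : A) : ℝ :=
  ∑ t, G.nextProb ξ s b t * v t

variable {G : ConcurrentGame S A} {T : Set S}

instance : Nonempty (Strategy G.mov₁) :=
  ⟨Strategy.ofMoves (fun _ s => (G.mov₁_nonempty s).choose)
    fun _ s => (G.mov₁_nonempty s).choose_spec⟩

instance : Nonempty (Strategy G.mov₂) :=
  ⟨Strategy.ofMoves (fun _ s => (G.mov₂_nonempty s).choose)
    fun _ s => (G.mov₂_nonempty s).choose_spec⟩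

instance : Nonempty (Selector G.mov₁) := ⟨(Classical.arbitrary (Strategy G.mov₁)).selectorAt []⟩

instance : Nonempty (Selector G.mov₂) := ⟨(Classical.arbitrary (Strategy G.mov₂)).selectorAt []⟩

theorem nextProb_nonneg (ξ : Selector G.mov₁) (s : S) (b : A) (t : S) :
    0 ≤ G.nextProb ξ s b t :=
  Finset.sum_nonneg fun a _ => mul_nonneg ((G.trans_mem s a b).1 t) ((ξ.act_mem s).1 a)

theorem sum_nextProb (ξ : Selector G.mov₁) (s : S) (b : A) : ∑ t, G.nextProb ξ s b t = 1 := by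
  unfold nextProb
  rw [Finset.sum_comm]
  simp_rw [← Finset.sum_mul, (G.trans_mem s _ b).2, one_mul]
  exact (ξ.act_mem s).2

theorem nextProb_pos_of_trans_pos {ξ : Selector G.mov₁} {s : S} {a b : A} {t : S}
    (ha : 0 < ξ.act s a) (ht : 0 < G.trans s a b t) : 0 < G.nextProb ξ s b t :=
  (mul_pos ht ha).trans_le (Finset.single_le_sum
    (f := fun a => G.trans s a b t * ξ.act s a)
    (fun a _ => mul_nonneg ((G.trans_mem s a b).1 t) ((ξ.act_mem s).1 a)) (Finset.mem_univ a))

theorem exists_pos_of_nextProb_pos {ξ : Selector G.mov₁} {s : S} {b : A} {t : S}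
    (h : 0 < G.nextProb ξ s b t) : ∃ a, 0 < ξ.act s a ∧ 0 < G.trans s a b t := by
  obtain ⟨a, -, ha⟩ := Finset.exists_lt_of_sum_lt (s := Finset.univ) (f := fun _ : A => (0 : ℝ))
    (g := fun a => G.trans s a b t * ξ.act s a) (by rw [Finset.sum_const_zero]; exact h)
  have h1 := (G.trans_mem s a b).1 t
  have h2 := (ξ.act_mem s).1 a
  exact ⟨a, pos_of_mul_pos_right ha h1, pos_of_mul_pos_left ha h2⟩

theorem moveVal_sub (ξ : Selector G.mov₁) (u v : S → ℝ) (s : S) (b : A) :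
    G.moveVal ξ (fun t => u t - v t) s b = G.moveVal ξ u s b - G.moveVal ξ v s b := by
  simp only [moveVal, mul_sub, Finset.sum_sub_distrib]

theorem moveVal_neg (ξ : Selector G.mov₁) (v : S → ℝ) (s : S) (b : A) :
    G.moveVal ξ (fun t => -v t) s b = -G.moveVal ξ v s b := by
  simp only [moveVal, mul_neg, Finset.sum_neg_distrib]

theorem moveVal_le_of_support {ξ : Selector G.mov₁} {v : S → ℝ} {s : S} {b : A} {m : ℝ}
    (h : ∀ t, 0 < G.nextProb ξ s b t → v t ≤ m) : G.moveVal ξ v s b ≤ m := by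
  calc G.moveVal ξ v s b ≤ ∑ t, G.nextProb ξ s b t * m := by
        refine Finset.sum_le_sum fun t _ => ?_
        rcases (nextProb_nonneg ξ s b t).eq_or_lt with h0 | h0
        · rw [← h0, zero_mul, zero_mul]
        · exact mul_le_mul_of_nonneg_left (h t h0) h0.le
    _ = m := by rw [← Finset.sum_mul, sum_nextProb, one_mul]

theorem moveVal_le_add {ξ : Selector G.mov₁} {u v : S → ℝ} {s : S} {b : A} {ε : ℝ}
    (h : ∀ t, u t ≤ v t + ε) : G.moveVal ξ u s b ≤ G.moveVal ξ v s b + ε := by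
  have := moveVal_le_of_support (G := G) (ξ := ξ) (v := fun t => u t - v t) (s := s) (b := b)
    (m := ε) fun t _ => by linarith [h t]
  rw [moveVal_sub] at this
  linarith

/-- If an average is at least the maximum, then it is an average of maxima. -/
theorem eq_of_le_moveVal {ξ : Selector G.mov₁} {v : S → ℝ} {s : S} {b : A} {m : ℝ}
    (h : ∀ t, 0 < G.nextProb ξ s b t → v t ≤ m) (hm : m ≤ G.moveVal ξ v s b) {t : S}
    (ht : 0 < G.nextProb ξ s b t) : v t = m := by
  have hz : ∑ t, G.nextProb ξ s b t * (m - v t) ≤ 0 := by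
    simp only [mul_sub, Finset.sum_sub_distrib, ← Finset.sum_mul, sum_nextProb, one_mul]
    exact sub_nonpos.2 hm
  have hnn : ∀ t ∈ Finset.univ, 0 ≤ G.nextProb ξ s b t * (m - v t) := fun t _ => by
    rcases (nextProb_nonneg ξ s b t).eq_or_lt with h0 | h0
    · rw [← h0, zero_mul]
    · exact mul_nonneg h0.le (sub_nonneg.2 (h t h0))
  have := (Finset.sum_eq_zero_iff_of_nonneg hnn).1 (le_antisymm hz (Finset.sum_nonneg hnn)) t
    (Finset.mem_univ t)
  rcases mul_eq_zero.1 this with h0 | h0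
  · exact absurd h0 ht.ne'
  · linarith

theorem preBoth_eq_sum_moveVal (ξ₁ : Selector G.mov₁) (ξ₂ : Selector G.mov₂) (v : S → ℝ) (s : S) :
    G.preBoth ξ₁ ξ₂ v s = ∑ b, ξ₂.act s b * G.moveVal ξ₁ v s b := by
  simp only [preBoth, moveVal, nextProb, Finset.mul_sum, Finset.sum_mul]
  rw [Finset.sum_comm]
  refine Finset.sum_congr rfl fun b _ => ?_
  rw [Finset.sum_comm]
  exact Finset.sum_congr rfl fun t _ => Finset.sum_congr rfl fun a _ => by ring

theorem sum_stepProb_mul (σ₁ : Strategy G.mov₁) (σ₂ : Strategy G.mov₂) (w : List S) (s : S)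
    (v : S → ℝ) : ∑ t, G.stepProb σ₁ σ₂ w s t * v t =
      G.preBoth (σ₁.selectorAt w) (σ₂.selectorAt w) v s := by
  simp only [preBoth, stepProb, Finset.sum_mul]
  rw [Finset.sum_comm]
  refine Finset.sum_congr rfl fun a _ => ?_
  rw [Finset.sum_comm]
  refine Finset.sum_congr rfl fun b _ => Finset.sum_congr rfl fun t _ => ?_
  simp only [Strategy.selectorAt]
  ring

theorem preBoth_ofMoves (ξ : Selector G.mov₁) (f : List S → S → A) (hf : ∀ w s, f w s ∈ G.mov₂ s)
    (w : List S) (v : S → ℝ) (s : S) :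
    G.preBoth ξ ((Strategy.ofMoves f hf).selectorAt w) v s = G.moveVal ξ v s (f w s) := by
  classical
  rw [preBoth_eq_sum_moveVal, Finset.sum_eq_single (f w s)]
  · simp [Strategy.selectorAt, Strategy.ofMoves]
  · intro b _ hb
    simp [Strategy.selectorAt, Strategy.ofMoves, Pi.single_eq_of_ne hb]
  · simp

theorem le_preBoth {ξ₁ : Selector G.mov₁} {v : S → ℝ} {s : S} {c : ℝ}
    (h : ∀ b ∈ G.mov₂ s, c ≤ G.moveVal ξ₁ v s b) (ξ₂ : Selector G.mov₂) :
    c ≤ G.preBoth ξ₁ ξ₂ v s := by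
  rw [preBoth_eq_sum_moveVal]
  calc c = ∑ b, ξ₂.act s b * c := by rw [← Finset.sum_mul, (ξ₂.act_mem s).2, one_mul]
    _ ≤ _ := by
        refine Finset.sum_le_sum fun b _ => ?_
        rcases ((ξ₂.act_mem s).1 b).eq_or_lt with h0 | h0
        · rw [← h0, zero_mul, zero_mul]
        · exact mul_le_mul_of_nonneg_left (h b (ξ₂.supp s b h0)) h0.le

theorem exists_moveVal_le (ξ : Selector G.mov₁) (v : S → ℝ) (s : S) :
    ∃ b ∈ G.mov₂ s, ∀ b' ∈ G.mov₂ s, G.moveVal ξ v s b ≤ G.moveVal ξ v s b' :=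
  Finset.exists_min_image _ _ (G.mov₂_nonempty s)

theorem preSel_le_preBoth (ξ₁ : Selector G.mov₁) (ξ₂ : Selector G.mov₂) (v : S → ℝ) (s : S) :
    G.preSel ξ₁ v s ≤ G.preBoth ξ₁ ξ₂ v s := by
  obtain ⟨b, -, hb⟩ := exists_moveVal_le ξ₁ v s
  refine ciInf_le ⟨G.moveVal ξ₁ v s b, ?_⟩ ξ₂
  rintro _ ⟨ξ, rfl⟩
  exact le_preBoth hb ξ

theorem preSel_le_moveVal (ξ : Selector G.mov₁) (v : S → ℝ) {s : S} {b : A} (hb : b ∈ G.mov₂ s) :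
    G.preSel ξ v s ≤ G.moveVal ξ v s b := by
  classical
  have := preSel_le_preBoth ξ ((Strategy.ofMoves (mov := G.mov₂)
    (fun _ s' => if s' = s then b else (G.mov₂_nonempty s').choose) fun _ s' => by
      split_ifs with h
      · exact h ▸ hb
      · exact (G.mov₂_nonempty s').choose_spec).selectorAt []) v s
  rwa [preBoth_ofMoves, if_pos rfl] at this

/-- The payoff is affine in the mixture of player 2, so a pure move attains the infimum. -/
theorem exists_preSel_eq_moveVal (ξ : Selector G.mov₁) (v : S → ℝ) (s : S) :
    ∃ b ∈ G.mov₂ s, G.preSel ξ v s = G.moveVal ξ v s b := by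
  obtain ⟨b, hbm, hb⟩ := exists_moveVal_le ξ v s
  exact ⟨b, hbm, le_antisymm (preSel_le_moveVal ξ v hbm) (le_ciInf (le_preBoth hb))⟩

theorem preSel_congr {ξ ξ' : Selector G.mov₁} {s : S} (h : ξ.act s = ξ'.act s) (v : S → ℝ) :
    G.preSel ξ v s = G.preSel ξ' v s := by
  simp only [preSel, preBoth, h]

theorem preSel_le_add {ξ : Selector G.mov₁} {u v : S → ℝ} {ε : ℝ} (h : ∀ t, u t ≤ v t + ε)
    (s : S) : G.preSel ξ u s ≤ G.preSel ξ v s + ε := by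
  obtain ⟨b, hb, hv⟩ := exists_preSel_eq_moveVal ξ v s
  rw [hv]
  exact (preSel_le_moveVal ξ u hb).trans (moveVal_le_add h)

theorem preSel_mono {ξ : Selector G.mov₁} {u v : S → ℝ} (h : ∀ t, u t ≤ v t)
    (s : S) : G.preSel ξ u s ≤ G.preSel ξ v s := by
  simpa using preSel_le_add (ξ := ξ) (ε := 0) (fun t => by simpa using h t) s

theorem preSel_le_pre (ξ : Selector G.mov₁) (v : S → ℝ) (s : S) : G.preSel ξ v s ≤ G.pre v s := by
  obtain ⟨M, hM⟩ := (Set.finite_range v).bddAbove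
  refine le_ciSup (f := fun ξ : Selector G.mov₁ => G.preSel ξ v s) ⟨M, ?_⟩ ξ
  rintro _ ⟨ξ, rfl⟩
  obtain ⟨b, -, hb⟩ := exists_preSel_eq_moveVal ξ v s
  exact hb.trans_le (moveVal_le_of_support fun t _ => hM ⟨t, rfl⟩)

theorem pre_le {v : S → ℝ} {s : S} {c : ℝ} (h : ∀ ξ : Selector G.mov₁, G.preSel ξ v s ≤ c) :
    G.pre v s ≤ c :=
  ciSup_le h

/-! ### Values of strategies and of the game -/

variable [MeasurableSpace S] [DiscreteMeasurableSpace S]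

theorem stratValue_le (σ₁ : Strategy G.mov₁) (σ₂ : Strategy G.mov₂) (Φ : Set (ℕ → S)) (s : S) :
    G.stratValue σ₁ Φ s ≤ (G.playMeasure σ₁ σ₂ s).real Φ :=
  ciInf_le ⟨0, by rintro _ ⟨σ, rfl⟩; exact measureReal_nonneg⟩ σ₂

theorem stratValue_nonneg (σ₁ : Strategy G.mov₁) (Φ : Set (ℕ → S)) (s : S) :
    0 ≤ G.stratValue σ₁ Φ s :=
  le_ciInf fun _ => measureReal_nonneg

theorem stratValue_le_one (σ₁ : Strategy G.mov₁) (Φ : Set (ℕ → S)) (s : S) :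
    G.stratValue σ₁ Φ s ≤ 1 :=
  (stratValue_le σ₁ (Classical.arbitrary _) Φ s).trans measureReal_le_one

theorem stratValue_le_val (σ₁ : Strategy G.mov₁) (Φ : Set (ℕ → S)) (s : S) :
    G.stratValue σ₁ Φ s ≤ G.val Φ s :=
  le_ciSup (f := fun σ => G.stratValue σ Φ s)
    ⟨1, by rintro _ ⟨σ, rfl⟩; exact stratValue_le_one σ Φ s⟩ σ₁

theorem val_nonneg (Φ : Set (ℕ → S)) (s : S) : 0 ≤ G.val Φ s :=
  (stratValue_nonneg (Classical.arbitrary _) Φ s).trans (stratValue_le_val _ Φ s)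

theorem stratValue_reach_of_mem (σ₁ : Strategy G.mov₁) {s : S} (hs : s ∈ T) :
    G.stratValue σ₁ (reach T) s = 1 := by
  simp only [stratValue, playMeasure_reach_of_mem hs, ciInf_const]

/-- Playing `ξ` once and then `γ` forever guarantees the one-step value of `γ`'s valuation. -/
theorem preSel_stratValue_le_cons (ξ : Selector G.mov₁) (σ₁ : Strategy G.mov₁) {s : S}
    (hs : s ∉ T) :
    G.preSel ξ (G.stratValue σ₁ (reach T)) s ≤
      G.stratValue (Strategy.cons ξ σ₁) (reach T) s := by
  refine le_ciInf fun σ₂ => ?_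
  rw [playMeasure_reach_of_notMem hs, Strategy.shift_cons]
  calc _ ≤ G.preBoth ξ (σ₂.selectorAt []) (G.stratValue σ₁ (reach T)) s :=
        preSel_le_preBoth _ _ _ _
    _ = ∑ t, G.stepProb (Strategy.cons ξ σ₁) σ₂ [] s t * G.stratValue σ₁ (reach T) t := by
        rw [sum_stepProb_mul]; rfl
    _ ≤ _ := Finset.sum_le_sum fun t _ =>
        mul_le_mul_of_nonneg_left (stratValue_le _ _ _ _) (G.stepProb_nonneg _ _ _ _ _)

theorem pre_stratValue_le_val (σ₁ : Strategy G.mov₁) {s : S} (hs : s ∉ T) :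
    G.pre (G.stratValue σ₁ (reach T)) s ≤ G.val (reach T) s :=
  pre_le fun ξ => (preSel_stratValue_le_cons ξ σ₁ hs).trans (stratValue_le_val _ _ _)

/-- Prefixing `γ` to its own memoryless strategy changes nothing. With `stratValue_le_preSel` this
is the Bellman equation for `γ`. -/
theorem preSel_stratValue_le (γ : Selector G.mov₁) {s : S} (hs : s ∉ T) :
    G.preSel γ (G.stratValue γ.memoryless (reach T)) s ≤
      G.stratValue γ.memoryless (reach T) s := by
  have h := preSel_stratValue_le_cons γ γ.memoryless hs
  have hc : Strategy.cons γ γ.memoryless = γ.memoryless := by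
    ext (_ | _) s a <;> rfl
  rwa [hc] at h

/-- Player 2 can play any `ξ` first and then an `ε`-optimal reply chosen according to the state
reached; `Strategy.select` glues these replies together. -/
theorem stratValue_le_preSel (γ : Selector G.mov₁) {s : S} (hs : s ∉ T) :
    G.stratValue γ.memoryless (reach T) s ≤
      G.preSel γ (G.stratValue γ.memoryless (reach T)) s := by
  refine le_ciInf fun ξ => le_of_forall_pos_le_add fun ε hε => ?_
  have hτ : ∀ t, ∃ τ : Strategy G.mov₂, (G.playMeasure γ.memoryless τ t).real (reach T) <
      G.stratValue γ.memoryless (reach T) t + ε := fun t =>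
    exists_lt_of_ciInf_lt (lt_add_of_pos_right _ hε)
  choose τ hτ using hτ
  refine (stratValue_le _ (Strategy.cons ξ (Strategy.select τ)) _ s).trans ?_
  rw [playMeasure_reach_of_notMem hs, Strategy.shift_cons, Selector.shift_memoryless]
  simp_rw [playMeasure_reach_select]
  calc _ ≤ ∑ t, G.stepProb γ.memoryless (Strategy.cons ξ (Strategy.select τ)) [] s t *
          (G.stratValue γ.memoryless (reach T) t + ε) := Finset.sum_le_sum fun t _ =>
        mul_le_mul_of_nonneg_left (hτ t).le (G.stepProb_nonneg _ _ _ _ _)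
    _ = G.preBoth γ ξ (G.stratValue γ.memoryless (reach T)) s + ε := by
        simp only [mul_add, Finset.sum_add_distrib, ← Finset.sum_mul, sum_stepProb, one_mul]
        rw [sum_stepProb_mul]; rfl

/-- Nonnegative valuations that are at least `1` on the target and superharmonic elsewhere bound
the value of the game from above. -/
theorem val_reach_le_of_pre_le {u : S → ℝ} (h0 : ∀ s, 0 ≤ u s) (hT : ∀ s ∈ T, 1 ≤ u s)
    (hu : ∀ s, s ∉ T → G.pre u s ≤ u s) (s : S) : G.val (reach T) s ≤ u s := by
  refine ciSup_le fun σ₁ => ?_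
  -- Player 2 answers each history with a pure move minimizing the expectation of `u` against the
  -- mixture `σ₁` prescribes there.
  choose f hf hfu using fun w s => exists_preSel_eq_moveVal (G := G) (σ₁.selectorAt w) u s
  have hR : ∀ n w s, G.reachWithin σ₁ (Strategy.ofMoves f hf) T n w s ≤ u s := by
    intro n
    induction n with
    | zero =>
      intro w s
      by_cases hs : s ∈ T
      · rw [reachWithin_of_mem hs]; exact hT s hs
      · rw [reachWithin_zero_of_notMem hs]; exact h0 s
    | succ n ih =>
      intro w s
      by_cases hs : s ∈ T
      · rw [reachWithin_of_mem hs]; exact hT s hs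
      · rw [reachWithin_succ_of_notMem hs]
        calc _ ≤ ∑ t, G.stepProb σ₁ (Strategy.ofMoves f hf) w s t * u t :=
              Finset.sum_le_sum fun t _ =>
                mul_le_mul_of_nonneg_left (ih _ t) (G.stepProb_nonneg _ _ _ _ _)
          _ = G.preSel (σ₁.selectorAt w) u s := by
              rw [sum_stepProb_mul, preBoth_ofMoves, hfu]
          _ ≤ u s := (preSel_le_pre _ _ _).trans (hu s hs)
  exact (stratValue_le σ₁ (Strategy.ofMoves f hf) _ s).trans
    (le_of_tendsto' (tendsto_reachWithin σ₁ _ T s) fun n => hR n [] s)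

/-! ### Traps and proper selectors -/

/-- Against `ξ`, player 2 can confine the play to `C`. -/
def IsTrap (G : ConcurrentGame S A) (ξ : Selector G.mov₁) (C : Set S) : Prop :=
  ∀ s ∈ C, ∃ b ∈ G.mov₂ s, ∀ t, 0 < G.nextProb ξ s b t → t ∈ C

/-- Against `ξ`, player 2 has no trap outside `T ∪ W₂`. -/
def IsTrapFree (G : ConcurrentGame S A) (T : Set S) (ξ : Selector G.mov₁) : Prop :=
  ∀ C : Set S, Disjoint C (T ∪ G.W₂ T) → G.IsTrap ξ C → C = ∅

/-- Maximum principle for selectors without traps. -/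
theorem IsTrapFree.le_of_le_moveVal {ξ : Selector G.mov₁} (hξ : G.IsTrapFree T ξ) {g : S → ℝ}
    {c : ℝ} (hg : ∀ s ∈ T ∪ G.W₂ T, g s ≤ c)
    (hmv : ∀ s, s ∉ T ∪ G.W₂ T → ∃ b ∈ G.mov₂ s, g s ≤ G.moveVal ξ g s b) (s : S) :
    g s ≤ c := by
  by_contra hs
  have : Nonempty S := ⟨s⟩
  obtain ⟨x, hx⟩ := Finite.exists_max g
  have hxc : c < g x := (not_le.1 hs).trans_le (hx s)
  have hout : ∀ y, g y = g x → y ∉ T ∪ G.W₂ T := fun y hy h => by linarith [hg y h]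
  -- The set where `g` attains its maximum is a trap: an average at least the maximum charges only
  -- maximizers.
  have hempty := hξ {y | g y = g x} (Set.disjoint_left.2 hout) fun y hy => by
    obtain ⟨b, hb, hle⟩ := hmv y (hout y hy)
    exact ⟨b, hb, fun t ht => eq_of_le_moveVal (fun t _ => hx t) (by rw [← hy]; exact hle) ht⟩
  exact (Set.ext_iff.1 hempty x).1 rfl

/-- The negated value of reaching `T ∪ W₂` obeys the maximum principle with boundary value `-1`, so
that value is `1` everywhere. -/
theorem IsTrapFree.isProper {γ : Selector G.mov₁} (hγ : G.IsTrapFree T γ) :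
    G.IsProper T γ.memoryless := by
  have h : ∀ s, -G.stratValue γ.memoryless (reach (T ∪ G.W₂ T)) s ≤ -1 :=
    hγ.le_of_le_moveVal (fun s hs => by rw [stratValue_reach_of_mem _ hs]) fun s hs => by
      obtain ⟨b, hb, heq⟩ := exists_preSel_eq_moveVal γ
        (G.stratValue γ.memoryless (reach (T ∪ G.W₂ T))) s
      refine ⟨b, hb, ?_⟩
      rw [moveVal_neg, ← heq]
      exact neg_le_neg (preSel_stratValue_le γ hs)
  intro σ₂ s _
  exact le_antisymm measureReal_le_one
    ((neg_le_neg_iff.1 (h s)).trans (stratValue_le _ σ₂ _ s))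

/-- Valuations that are subharmonic for a selector without traps bound its value from below. -/
theorem IsTrapFree.le_stratValue {γ : Selector G.mov₁} (hγ : G.IsTrapFree T γ) {v : S → ℝ}
    (hT : ∀ s ∈ T, v s ≤ 1) (hW : ∀ s ∈ G.W₂ T, v s ≤ 0)
    (hv : ∀ s, s ∉ T ∪ G.W₂ T → v s ≤ G.preSel γ v s) (s : S) :
    v s ≤ G.stratValue γ.memoryless (reach T) s := by
  refine sub_nonpos.1 (hγ.le_of_le_moveVal
    (g := fun s => v s - G.stratValue γ.memoryless (reach T) s) ?_ ?_ s)
  · rintro s (hs | hs)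
    · rw [stratValue_reach_of_mem _ hs]
      exact sub_nonpos.2 (hT s hs)
    · exact sub_nonpos.2 ((hW s hs).trans (stratValue_nonneg _ _ _))
  · intro s hs
    -- The move is chosen optimal against the value of `γ`; `v` is subharmonic under every move, so
    -- the difference is subharmonic under this one.
    obtain ⟨b, hb, heq⟩ := exists_preSel_eq_moveVal γ (G.stratValue γ.memoryless (reach T)) s
    refine ⟨b, hb, ?_⟩
    rw [moveVal_sub, ← heq]
    exact sub_le_sub ((hv s hs).trans (preSel_le_moveVal γ v hb))
      (preSel_stratValue_le γ fun h => hs (Or.inl h))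

/-- Uniform play gives every available move positive probability, so a reply confining it to `C`
confines every selector. The indicator of the complement of `C` is then superharmonic, the value
vanishes on `C`, and `C ⊆ W₂`. -/
theorem IsUniform.isTrapFree {γ : Selector G.mov₁} (hγ : G.IsUniform T γ) :
    G.IsTrapFree T γ := by
  classical
  intro C hC htrap
  have hval : ∀ s, G.val (reach T) s ≤ if s ∈ C then 0 else 1 := by
    refine val_reach_le_of_pre_le (fun s => by positivity) (fun s hs => ?_) fun s _ => ?_
    · rw [if_neg fun h => Set.disjoint_left.1 hC h (Or.inl hs)]
    · refine pre_le fun ξ => ?_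
      by_cases hs : s ∈ C
      · obtain ⟨b, hb, hbC⟩ := htrap s hs
        rw [if_pos hs]
        refine (preSel_le_moveVal ξ _ hb).trans (moveVal_le_of_support fun t ht => ?_)
        obtain ⟨a, ha, hat⟩ := exists_pos_of_nextProb_pos ht
        have ham := ξ.supp s a ha
        have hγa : 0 < γ.act s a := by
          rw [hγ s (Set.disjoint_left.1 hC hs) a ham]
          exact one_div_pos.2 (Nat.cast_pos.2 (Finset.card_pos.2 ⟨a, ham⟩))
        rw [if_pos (hbC t (nextProb_pos_of_trans_pos hγa hat))]
      · obtain ⟨b, hb, heq⟩ := exists_preSel_eq_moveVal ξ (fun s => if s ∈ C then (0 : ℝ) else 1) s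
        rw [if_neg hs, heq]
        exact moveVal_le_of_support fun t _ => by split_ifs <;> norm_num
  refine Set.eq_empty_of_forall_notMem fun s hs => Set.disjoint_left.1 hC hs (Or.inr ?_)
  have := hval s
  rw [if_pos hs] at this
  exact le_antisymm this (val_nonneg _ _)

/-! ### Improvement steps -/

section Improvement

variable {γ γ' : Selector G.mov₁}

theorem ImprovementStep.preSel_eq_pre (h : G.ImprovementStep T γ γ') {s : S}
    (hs : s ∈ G.improvable T (G.stratValue γ.memoryless (reach T))) :
    G.preSel γ' (G.stratValue γ.memoryless (reach T)) s =
      G.pre (G.stratValue γ.memoryless (reach T)) s := by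
  obtain ⟨ξ, hξ, hγ'⟩ := h
  rw [preSel_congr ((hγ' s).2 hs), hξ s hs]

theorem ImprovementStep.act_eq (h : G.ImprovementStep T γ γ') {s : S}
    (hs : s ∉ G.improvable T (G.stratValue γ.memoryless (reach T))) : γ'.act s = γ.act s := by
  obtain ⟨ξ, -, hγ'⟩ := h
  exact (hγ' s).1 hs

theorem ImprovementStep.stratValue_le_preSel (h : G.ImprovementStep T γ γ') {s : S}
    (hs : s ∉ T) :
    G.stratValue γ.memoryless (reach T) s ≤
      G.preSel γ' (G.stratValue γ.memoryless (reach T)) s := by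
  by_cases hI : s ∈ G.improvable T (G.stratValue γ.memoryless (reach T))
  · rw [h.preSel_eq_pre hI]
    exact hI.2.le
  · rw [preSel_congr (h.act_eq hI)]
    exact ConcurrentGame.stratValue_le_preSel γ hs

/-- In a trap for `γ'`, consider the states maximizing the old valuation. The confining reply keeps
the one-step value at most the maximum, so none of these states is improvable; there `γ'` agrees
with `γ`, and the maximizers form a trap for `γ`. -/
theorem ImprovementStep.isTrapFree (h : G.ImprovementStep T γ γ') (hγ : G.IsTrapFree T γ) :
    G.IsTrapFree T γ' := by
  intro C hC htrap
  by_contra hne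
  obtain ⟨x, hxC, hx⟩ := Set.exists_max_image C (G.stratValue γ.memoryless (reach T))
    C.toFinite (Set.nonempty_iff_ne_empty.2 hne)
  set v := G.stratValue γ.memoryless (reach T) with hv
  have hempty := hγ {y | y ∈ C ∧ v y = v x} (hC.mono_left fun y hy => hy.1) fun y hy => by
    obtain ⟨b, hb, hbC⟩ := htrap y hy.1
    have hmax : ∀ t, 0 < G.nextProb γ' y b t → v t ≤ v x := fun t ht => hx t (hbC t ht)
    have hpre : G.preSel γ' v y ≤ v y :=
      (preSel_le_moveVal γ' v hb).trans (hy.2.symm ▸ moveVal_le_of_support hmax)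
    have hle : v y ≤ G.moveVal γ' v y b :=
      (h.stratValue_le_preSel fun hT => Set.disjoint_left.1 hC hy.1 (Or.inl hT)).trans
        (preSel_le_moveVal γ' v hb)
    have hI : y ∉ G.improvable T v := fun hI => by
      have := hI.2
      rw [← h.preSel_eq_pre hI] at this
      exact this.not_ge hpre
    have hact := h.act_eq hI
    refine ⟨b, hb, fun t ht => ?_⟩
    have ht' : 0 < G.nextProb γ' y b t := by simpa only [nextProb, hact] using ht
    exact ⟨hbC t ht', eq_of_le_moveVal hmax (hy.2 ▸ hle) ht'⟩
  exact (Set.ext_iff.1 hempty x).1 ⟨hxC, rfl⟩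

theorem ImprovementStep.stratValue_mono (h : G.ImprovementStep T γ γ') (hγ : G.IsTrapFree T γ)
    (s : S) :
    G.stratValue γ.memoryless (reach T) s ≤ G.stratValue γ'.memoryless (reach T) s :=
  (h.isTrapFree hγ).le_stratValue (fun s _ => stratValue_le_one _ _ s)
    (fun s (hs : G.val (reach T) s = 0) => (stratValue_le_val _ _ s).trans hs.le)
    (fun _ hs => h.stratValue_le_preSel fun hT => hs (Or.inl hT)) s

/-- For the old and new valuations `v ≤ v'`: `Pre₁(v) = Pre_{γ'}(v) ≤ Pre_{γ'}(v') ≤ v'`. -/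
theorem ImprovementStep.pre_le_stratValue_of_mem (h : G.ImprovementStep T γ γ')
    (hγ : G.IsTrapFree T γ) {s : S}
    (hs : s ∈ G.improvable T (G.stratValue γ.memoryless (reach T))) :
    G.pre (G.stratValue γ.memoryless (reach T)) s ≤ G.stratValue γ'.memoryless (reach T) s := by
  rw [← h.preSel_eq_pre hs]
  exact (preSel_mono (h.stratValue_mono hγ) s).trans
    (preSel_stratValue_le γ' fun hT => hs.1 (Or.inl hT))

theorem ImprovementStep.pre_le_stratValue (h : G.ImprovementStep T γ γ')
    (hγ : G.IsTrapFree T γ) {s : S} (hs : s ∉ T ∪ G.W₂ T) :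
    G.pre (G.stratValue γ.memoryless (reach T)) s ≤ G.stratValue γ'.memoryless (reach T) s := by
  by_cases hI : s ∈ G.improvable T (G.stratValue γ.memoryless (reach T))
  · exact h.pre_le_stratValue_of_mem hγ hI
  · exact (not_lt.1 fun hlt => hI ⟨hs, hlt⟩).trans (h.stratValue_mono hγ s)

/-- The valuation is superharmonic off `T`, hence bounds the game value. On `W₂`, which `improvable`
excludes, this holds because its one-step value is at most the game value `0`. -/
theorem isOptimal_of_improvable_eq_empty
    (h : G.improvable T (G.stratValue γ.memoryless (reach T)) = ∅) :
    G.IsOptimal γ.memoryless (reach T) := fun s => by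
  refine le_antisymm (stratValue_le_val _ _ s) (val_reach_le_of_pre_le (stratValue_nonneg _ _)
    (fun s hs => (stratValue_reach_of_mem _ hs).ge) (fun s hs => ?_) s)
  by_cases hW : s ∈ G.W₂ T
  · have hW' : G.val (reach T) s = 0 := hW
    exact (pre_stratValue_le_val _ hs).trans (hW'.trans_le (stratValue_nonneg _ _ s))
  · exact not_lt.1 fun hlt =>
      (Set.ext_iff.1 h s).1 ⟨fun hs' => hs'.elim hs hW, hlt⟩

theorem ImprovementStep.precEq (h : G.ImprovementStep T γ γ') (hγ : G.IsTrapFree T γ) :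
    G.PrecEq T γ.memoryless γ'.memoryless := by
  rcases Set.eq_empty_or_nonempty (G.improvable T (G.stratValue γ.memoryless (reach T)))
    with hI | ⟨s, hs⟩
  · right
    congr 1
    ext s a
    rw [h.act_eq (by rw [hI]; exact Set.notMem_empty s)]
  · exact Or.inl ⟨h.stratValue_mono hγ, s, hs.2.trans_le (h.pre_le_stratValue_of_mem hγ hs)⟩

theorem ImprovementStep.isOptimal_of_eq (h : G.ImprovementStep T γ γ') (hγ : G.IsTrapFree T γ)
    (heq : γ.memoryless = γ'.memoryless) : G.IsOptimal γ.memoryless (reach T) := by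
  refine isOptimal_of_improvable_eq_empty (Set.eq_empty_of_forall_notMem fun s hs => ?_)
  have := hs.2.trans_le (h.pre_le_stratValue_of_mem hγ hs)
  rw [heq] at this
  exact lt_irrefl _ this

end Improvement

theorem IsRun.isTrapFree {γ : ℕ → Selector G.mov₁} (hγ : G.IsRun T γ) (i : ℕ) :
    G.IsTrapFree T (γ i) := by
  induction i with
  | zero => exact hγ.1.isTrapFree
  | succ i ih => exact (hγ.2 i).isTrapFree ih

theorem IsRun.tendsto_stratValue {γ : ℕ → Selector G.mov₁} (hγ : G.IsRun T γ) :
    Tendsto (fun i => G.stratValue (γ i).memoryless (reach T)) atTop (𝓝 (G.val (reach T))) := by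
  set v := fun i => G.stratValue (γ i).memoryless (reach T) with hv
  have hmono : Monotone v := monotone_nat_of_le_succ fun i =>
    (hγ.2 i).stratValue_mono (hγ.isTrapFree i)
  have hbdd : ∀ s, BddAbove (Set.range fun i => v i s) := fun s =>
    ⟨1, by rintro _ ⟨i, rfl⟩; exact stratValue_le_one _ _ s⟩
  set u : S → ℝ := fun s => ⨆ i, v i s with hu
  have hvu : ∀ i s, v i s ≤ u s := fun i s => le_ciSup (hbdd s) i
  have hlim : ∀ s, Tendsto (fun i => v i s) atTop (𝓝 (u s)) := fun s =>
    tendsto_atTop_ciSup (fun i j hij => hmono hij s) (hbdd s)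
  have hu0 : ∀ s, 0 ≤ u s := fun s => (stratValue_nonneg _ _ s).trans (hvu 0 s)
  have hpre : ∀ i s, s ∉ T → G.pre (v i) s ≤ u s := fun i s hs => by
    by_cases hW : s ∈ G.W₂ T
    · have hW' : G.val (reach T) s = 0 := hW
      exact (pre_stratValue_le_val _ hs).trans (hW'.trans_le (hu0 s))
    · exact ((hγ.2 i).pre_le_stratValue (hγ.isTrapFree i) fun h => h.elim hs hW).trans
        (hvu (i + 1) s)
  have hval : u = G.val (reach T) := by
    refine funext fun s => le_antisymm (ciSup_le fun i => stratValue_le_val _ _ s)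
      (val_reach_le_of_pre_le hu0
        (fun s hs => (stratValue_reach_of_mem (γ 0).memoryless hs).ge.trans (hvu 0 s))
        (fun s hs => pre_le fun ξ => le_of_forall_pos_le_add fun ε hε => ?_) s)
    -- As `S` is finite, one index is `ε`-close to the limit at all states; the one-step operator
    -- loses at most `ε`, and `Pre₁(v i) ≤ u` off `T`.
    have hev : ∀ᶠ i in atTop, ∀ t, u t - ε < v i t := eventually_all.2 fun t =>
      (hlim t).eventually_const_lt (sub_lt_self _ hε)
    obtain ⟨i, hi⟩ := hev.exists
    calc G.preSel ξ u s ≤ G.preSel ξ (v i) s + ε :=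
          preSel_le_add (fun t => by linarith [hi t]) s
      _ ≤ u s + ε := by linarith [preSel_le_pre ξ (v i) s, hpre i s hs]
  rw [← hval]
  exact tendsto_pi_nhds.2 hlim

end ConcurrentGame

theorem theorem3 {S A : Type*} [Fintype S] [Fintype A]
    [MeasurableSpace S] [DiscreteMeasurableSpace S]
    (G : ConcurrentGame S A) (T : Set S)
    (γ : ℕ → Selector G.mov₁) (hγ : G.IsRun T γ) :
    (∀ i, G.PrecEq T (γ i).memoryless (γ (i + 1)).memoryless ∧
      ((γ i).memoryless = (γ (i + 1)).memoryless →
        G.IsOptimal (γ i).memoryless (ConcurrentGame.reach T))) ∧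
    (∀ i, G.IsProper T (γ i).memoryless) ∧
    Tendsto (fun i => G.stratValue (γ i).memoryless (ConcurrentGame.reach T)) atTop
      (𝓝 (G.val (ConcurrentGame.reach T))) := by
  exact ⟨fun i => ⟨(hγ.2 i).precEq (hγ.isTrapFree i), (hγ.2 i).isOptimal_of_eq (hγ.isTrapFree i)⟩,
    fun i => (hγ.isTrapFree i).isProper, hγ.tendsto_stratValue⟩
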